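/- Let $C\subset[0,1]$ be the middle-third Cantor set, and for $n,k\in\mathbb Z$ write $3^{-n}(C+k)=\{3^{-n}(x+k):x\in C\}$. Let $$\mathcal R:=\bigcup\{3^{-n}(C+k):k,n\in\mathbb Z\}\subset\mathbb R .$$ There is exactly one $\sigma$-finite Borel measure $\nu$ on $\mathcal R$ such that $\nu(C)=1$, $\nu$ is invariant under the translations $x\mapsto x+m$ ($m\in\mathbb Z$) of $\mathcal R$, and, for every $f\in L^1(\mathcal R,\nu)$, the function $x\mapsto f(3^{-1}x)$ is in $L^1(\mathcal R,\nu)$ and $$\int f(x)\,d\nu(x)=2^{-1}\int f(3^{-1}x)\,d\nu(x).$$ Let $\psi_1=2^{1/2}\chi_{3^{-1}(C+1)}$ and $\psi_2=\chi_{3^{-1}C}-\chi_{3^{-1}(C+2)}$. Then the family $$\psi_{i,j,k}(x)=2^{j/2}\psi_i(3^jx-k),\qquad i=1,2,\ j\in\mathbb Z,\ k\in\mathbb Z,$$ is an orthonormal basis of the complex Hilbert space $L^2(\mathcal R,\nu)$. -/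

import Mathlib

open MeasureTheory Set
open scoped ENNReal

noncomputable section

namespace CantorWavelet

/-- The set `3⁻ⁿ (C + k)`, where `C` is the middle-third Cantor set in `[0, 1]`. -/
def cantorCopy (n k : ℤ) : Set ℝ :=
  (fun x : ℝ => (3 : ℝ) ^ (-n) * (x + k)) '' cantorSet

/-- The filled-out Cantor set `R`, the union of all `3⁻ⁿ (C + k)` with `n` and `k` integers. -/
def filledCantorSet : Set ℝ := ⋃ (n : ℤ) (k : ℤ), cantorCopy n k

theorem mem_filledCantorSet {x : ℝ} :
    x ∈ filledCantorSet ↔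
      ∃ n k : ℤ, ∃ c ∈ cantorSet, (3 : ℝ) ^ (-n) * (c + k) = x := by
  simp [filledCantorSet, cantorCopy]

theorem exists_nat_rep {x : ℝ} (hx : x ∈ filledCantorSet) :
    ∃ (n : ℕ) (k : ℤ), ∃ c ∈ cantorSet, (3 : ℝ) ^ (-(n : ℤ)) * (c + k) = x := by
  have key : ∀ p : ℕ, ∀ c ∈ cantorSet, ∀ k : ℤ,
      ∃ c' ∈ cantorSet, ∃ k' : ℤ, (3 : ℝ) ^ p * (c + k) = c' + k' := by
    intro p
    induction p with
    | zero => intro c hc k; exact ⟨c, hc, k, by simp⟩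
    | succ p ih =>
      intro c hc k
      rw [cantorSet_eq_union_halves] at hc
      rcases hc with ⟨d, hd, rfl⟩ | ⟨d, hd, rfl⟩
      · obtain ⟨c', hc', k', h⟩ := ih d hd (3 * k)
        refine ⟨c', hc', k', ?_⟩
        rw [← h]; push_cast; ring
      · obtain ⟨c', hc', k', h⟩ := ih d hd (3 * k + 2)
        refine ⟨c', hc', k', ?_⟩
        rw [← h]; push_cast; ring
  obtain ⟨n, k, c, hc, rfl⟩ := mem_filledCantorSet.1 hx
  rcases le_total 0 n with hn | hn
  · lift n to ℕ using hn
    exact ⟨n, k, c, hc, rfl⟩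
  · obtain ⟨p, hp⟩ : ∃ p : ℕ, -n = p := ⟨(-n).toNat, by omega⟩
    obtain ⟨c', hc', k', h⟩ := key p c hc k
    refine ⟨0, k', c', hc', ?_⟩
    rw [hp, zpow_natCast, h]
    simp

theorem add_int_mem {x : ℝ} (hx : x ∈ filledCantorSet) (m : ℤ) :
    x + m ∈ filledCantorSet := by
  obtain ⟨n, k, c, hc, rfl⟩ := exists_nat_rep hx
  refine mem_filledCantorSet.2 ⟨n, k + 3 ^ n * m, c, hc, ?_⟩
  have h3 : (3 : ℝ) ^ n ≠ 0 := by positivity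
  rw [zpow_neg, zpow_natCast]
  push_cast
  field_simp
  ring

theorem third_mem {x : ℝ} (hx : x ∈ filledCantorSet) :
    (3 : ℝ)⁻¹ * x ∈ filledCantorSet := by
  obtain ⟨n, k, c, hc, rfl⟩ := mem_filledCantorSet.1 hx
  refine mem_filledCantorSet.2 ⟨n + 1, k, c, hc, ?_⟩
  rw [neg_add, zpow_add₀ (by norm_num : (3 : ℝ) ≠ 0), zpow_neg_one]
  ring

/-- The translation `x ↦ x + m` of `R` by an integer `m`. -/
def translate (m : ℤ) (x : filledCantorSet) : filledCantorSet :=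
  ⟨(x : ℝ) + m, add_int_mem x.2 m⟩

/-- The contraction `x ↦ 3⁻¹ x` of `R`. -/
def third (x : filledCantorSet) : filledCantorSet :=
  ⟨(3 : ℝ)⁻¹ * (x : ℝ), third_mem x.2⟩

/-- The characterizing properties of the measure on `R`: a (σ-finite) Borel measure which gives
`C` measure `1`, is invariant under integer translations, and satisfies
`∫ f(x) dν(x) = 2⁻¹ ∫ f(3⁻¹ x) dν(x)` for every `f` in `L¹(R, ν)`. -/
structure IsCantorMeasure (ν : Measure filledCantorSet) : Prop where
  sigmaFinite : SigmaFinite ν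
  measure_cantorSet : ν {x | (x : ℝ) ∈ cantorSet} = 1
  invariant : ∀ m : ℤ, MeasurePreserving (translate m) ν ν
  dilation : ∀ f : filledCantorSet → ℂ, Integrable f ν →
    Integrable (fun x => f (third x)) ν ∧
      ∫ x, f x ∂ν = (2 : ℂ)⁻¹ * ∫ x, f (third x) ∂ν

/-- The Cantor probability measure on `ℝ`: the law of the random point of `C` whose ternary
digits, each `0` or `2`, are given by independent fair coin tosses. -/
def cantorProb : Measure ℝ :=
  (Measure.infinitePi fun _ : ℕ => (PMF.uniformOfFintype Bool).toMeasure).map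
    fun y => (cantorSetHomeomorphNatToBool.symm y : ℝ)

/-- The image of the Cantor probability measure under `x ↦ 3⁻ⁿ (x + k)`, scaled to have total
mass `2⁻ⁿ`; it lives on `3⁻ⁿ (C + k)`. -/
def copyMeasure (n : ℕ) (k : ℤ) : Measure ℝ :=
  (2 : ℝ≥0∞)⁻¹ ^ n • cantorProb.map fun x : ℝ => (3 : ℝ) ^ (-(n : ℤ)) * (x + k)

/-- The measure on `ℝ` underlying `ν`. Up to single points, `R` is the disjoint union of the sets
`C + k` and of the sets `3⁻⁽ⁿ⁺¹⁾ (C + (3 k + 1))` with `n ≥ 0`, which lie in the middle thirds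
that are missing from the sets `3⁻ⁿ (C + k)`. -/
def filledCantorMeasureReal : Measure ℝ :=
  Measure.sum (fun k : ℤ => copyMeasure 0 k) +
    Measure.sum fun p : ℕ × ℤ => copyMeasure (p.1 + 1) (3 * p.2 + 1)

/-- The measure `ν` on `R`. -/
def filledCantorMeasure : Measure filledCantorSet :=
  filledCantorMeasureReal.comap (fun x : filledCantorSet => (x : ℝ))

/-- The wavelets: `ψ 0 = 2^{1/2} χ_{3⁻¹(C+1)}` and `ψ 1 = χ_{3⁻¹ C} - χ_{3⁻¹(C+2)}`. -/
def psi : Fin 2 → ℝ → ℂ :=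
  ![(cantorCopy 1 1).indicator fun _ => ((2 : ℝ) ^ (1 / 2 : ℝ) : ℝ),
    fun x => (cantorCopy 1 0).indicator 1 x - (cantorCopy 1 2).indicator 1 x]

/-- The function `x ↦ 2^{j/2} ψ_i(3^j x - k)` on `R`. -/
def waveletFun (i : Fin 2) (j k : ℤ) (x : filledCantorSet) : ℂ :=
  (((2 : ℝ) ^ ((j : ℝ) / 2) : ℝ) : ℂ) * psi i ((3 : ℝ) ^ j * (x : ℝ) - k)

end CantorWavelet

end

/-! Everything rests on the self-similarity C = C/3 ∪ (C+2)/3: a copy of level n is the union of two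
copies of level n+1, its outer thirds, and meets the middle third only in endpoints.

Existence: the coin-toss law on C satisfies the matching identity (`cantorProb_eq`). It gives the
explicit sum `filledCantorMeasureReal` invariance under integer translations and doubling under x ↦
x/3. Uniqueness: the axioms force mass 2⁻ⁿ on each copy of level n and mass 0 on the triadic
rationals (`measure_copySet`, `measure_triadicPoints`). Modulo those points the copies inside a
given copy determine all its measurable subsets (`inter_copySet_induction`), hence the measure.

Basis: a wavelet of level j is orthogonal to every characteristic function of a copy of level at
most j (`inner_chi_wavelet`), while wavelets of smaller level are combinations of such functions;
this gives orthogonality across scales. If f is orthogonal to all wavelets, its coefficient on a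
copy is either 0 or half of that on the parent copy. Going up d levels multiplies the norm of the
characteristic function only by 2^(d/2), so Cauchy–Schwarz forces every coefficient to vanish
(`inner_chi_eq_zero`). Then f has integral 0 over every copy, so f = 0. -/

namespace CantorWavelet

/-! ### Fair coin tosses -/

/-- The law of a sequence of independent fair coin tosses. -/
noncomputable def coinMeasure : Measure (ℕ → Bool) :=
  Measure.infinitePi fun _ : ℕ => (PMF.uniformOfFintype Bool).toMeasure

instance : IsProbabilityMeasure coinMeasure := by
  unfold coinMeasure; infer_instance

/-- Prepend a bit to a sequence of bits. -/
def consBit (b : Bool) (y : ℕ → Bool) : ℕ → Bool := fun n => Nat.casesOn n b y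

@[simp] theorem consBit_zero (b : Bool) (y : ℕ → Bool) : consBit b y 0 = b := rfl

@[simp] theorem consBit_succ (b : Bool) (y : ℕ → Bool) (n : ℕ) : consBit b y (n + 1) = y n := rfl

theorem measurable_consBit (b : Bool) : Measurable (consBit b) := by
  refine measurable_pi_iff.2 fun n => ?_
  cases n with
  | zero => exact measurable_const
  | succ n => exact measurable_pi_apply n

/-- Padding with full factors, of mass 1, makes the constrained coordinates an initial segment
containing 0, so that the first toss can be split off and the others shifted. -/
theorem pi_eq_pi_range (s : Finset ℕ) (t : ℕ → Set Bool) :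
    ∃ (N : ℕ) (u : ℕ → Set Bool), (s : Set ℕ).pi t = ((Finset.range (N + 1) : Finset ℕ) : Set ℕ).pi u ∧
      ∏ i ∈ s, (PMF.uniformOfFintype Bool).toMeasure (t i) =
        ∏ i ∈ Finset.range (N + 1), (PMF.uniformOfFintype Bool).toMeasure (u i) := by
  classical
  have hs : s ⊆ Finset.range (s.sup id + 1) := fun i hi => by
    have := Finset.le_sup (f := id) hi
    simp only [id] at this
    simp only [Finset.mem_range]
    omega
  refine ⟨s.sup id, fun i => if i ∈ s then t i else univ, ?_, ?_⟩
  · ext y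
    simp only [Set.mem_pi, Finset.mem_coe]
    constructor
    · intro h i _
      by_cases hi : i ∈ s <;> simp [hi, h]
    · intro h i hi
      simpa [hi] using h i (hs hi)
  · rw [← Finset.prod_subset hs]
    · exact Finset.prod_congr rfl fun i hi => by simp [hi]
    · intro i _ hi
      simp only [hi, if_false, measure_univ]

theorem consBit_preimage_pi (b : Bool) (N : ℕ) (u : ℕ → Set Bool) :
    consBit b ⁻¹' ((Finset.range (N + 1) : Finset ℕ) : Set ℕ).pi u =
      {y | b ∈ u 0 ∧ y ∈ ((Finset.range N : Finset ℕ) : Set ℕ).pi fun i => u (i + 1)} := by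
  ext y
  simp only [mem_preimage, Set.mem_pi, Finset.coe_range, mem_Iio, mem_ofPred_eq]
  constructor
  · exact fun h => ⟨h 0 (by omega), fun i hi => h (i + 1) (by omega)⟩
  · rintro ⟨h0, h⟩ i hi
    cases i with
    | zero => exact h0
    | succ i => exact h i (by omega)

/-- Conditioning on the first toss. A product measure is determined by its values on finite boxes,
where the claim reduces to the four possible subsets of `Bool` for coordinate 0. -/
theorem coinMeasure_eq :
    coinMeasure = (2 : ℝ≥0∞)⁻¹ • coinMeasure.map (consBit false) +
      (2 : ℝ≥0∞)⁻¹ • coinMeasure.map (consBit true) := by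
  symm
  conv_rhs => rw [coinMeasure]
  refine Measure.eq_infinitePi _ fun s t _ => ?_
  obtain ⟨N, u, h, h'⟩ := pi_eq_pi_range s t
  have hm : MeasurableSet (((Finset.range (N + 1) : Finset ℕ) : Set ℕ).pi u) :=
    MeasurableSet.pi (Finset.countable_toSet _) fun i _ => (u i).toFinite.measurableSet
  have hb : ∀ b, coinMeasure (consBit b ⁻¹' ((Finset.range (N + 1) : Finset ℕ) : Set ℕ).pi u) =
      (u 0).indicator 1 b *
        ∏ i ∈ Finset.range N, (PMF.uniformOfFintype Bool).toMeasure (u (i + 1)) := by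
    intro b
    rw [consBit_preimage_pi]
    by_cases hb : b ∈ u 0
    · simp only [hb, true_and, indicator_of_mem, Pi.one_apply, one_mul]
      exact Measure.infinitePi_pi _ fun i _ => (u (i + 1)).toFinite.measurableSet
    · simp [hb]
  rw [h, h', Finset.prod_range_succ', Measure.add_apply, Measure.smul_apply, Measure.smul_apply,
    Measure.map_apply (measurable_consBit _) hm, Measure.map_apply (measurable_consBit _) hm,
    hb, hb, PMF.toMeasure_apply_fintype]
  by_cases h0 : false ∈ u 0 <;> by_cases h1 : true ∈ u 0 <;>
    simp [h0, h1] <;> ring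

/-! ### The Cantor probability measure -/

theorem symm_consBit (b : Bool) (y : ℕ → Bool) :
    (cantorSetHomeomorphNatToBool.symm (consBit b y) : ℝ) =
      ((cantorSetHomeomorphNatToBool.symm y : ℝ) + cond b 2 0) / 3 := by
  change Real.ofDigits (fun i => cond (consBit b y i) (2 : Fin 3) 0) =
    (Real.ofDigits (fun i => cond (y i) (2 : Fin 3) 0) + cond b 2 0) / 3
  rw [Real.ofDigits_eq_sum_add_ofDigits _ 1]
  cases b <;> simp [Real.ofDigitsTerm, add_comm] <;> ring

theorem measurable_cantorPoint :
    Measurable fun y : ℕ → Bool => (cantorSetHomeomorphNatToBool.symm y : ℝ) :=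
  (continuous_subtype_val.comp cantorSetHomeomorphNatToBool.symm.continuous).measurable

theorem cantorProb_eq_map :
    cantorProb = coinMeasure.map fun y => (cantorSetHomeomorphNatToBool.symm y : ℝ) := rfl

instance : IsProbabilityMeasure cantorProb := by
  rw [cantorProb_eq_map]
  exact Measure.isProbabilityMeasure_map measurable_cantorPoint.aemeasurable

theorem cantorProb_compl : cantorProb cantorSetᶜ = 0 := by
  rw [cantorProb_eq_map, Measure.map_apply measurable_cantorPoint
    isClosed_cantorSet.measurableSet.compl]
  simp [preimage]

/-- Prepending a bit to the coin sequence acts on the Cantor point as x ↦ x/3 or x ↦ (x+2)/3, so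
this is the image of `coinMeasure_eq`. -/
theorem cantorProb_eq :
    cantorProb = (2 : ℝ≥0∞)⁻¹ • cantorProb.map (fun x => x / 3) +
      (2 : ℝ≥0∞)⁻¹ • cantorProb.map (fun x => (x + 2) / 3) := by
  conv_lhs => rw [cantorProb_eq_map, coinMeasure_eq,
    Measure.map_add _ _ measurable_cantorPoint, Measure.map_smul, Measure.map_smul,
    Measure.map_map measurable_cantorPoint (measurable_consBit _),
    Measure.map_map measurable_cantorPoint (measurable_consBit _)]
  rw [cantorProb_eq_map, Measure.map_map (by fun_prop) measurable_cantorPoint,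
    Measure.map_map (by fun_prop) measurable_cantorPoint]
  congr 3 <;> ext y <;> simp [symm_consBit]

theorem eq_zero_of_eq_inv_two_mul {x : ℝ≥0∞} (hx : x ≠ ∞) (h : x = 2⁻¹ * x) : x = 0 := by
  lift x to NNReal using hx
  have h2 : (2 : ℝ≥0∞)⁻¹ = ((2⁻¹ : NNReal) : ℝ≥0∞) := by norm_num
  rw [h2] at h
  norm_cast at h ⊢
  have h' : (x : ℝ) = 2⁻¹ * x := by
    conv_lhs => rw [h]
    simp
  exact NNReal.coe_eq_zero.1 (by linarith)

theorem cantorProb_singleton_of_notMem {x : ℝ} (hx : x ∉ cantorSet) : cantorProb {x} = 0 :=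
  measure_mono_null (by simpa using hx) cantorProb_compl

theorem cantorProb_singleton (x : ℝ) :
    cantorProb {x} = 2⁻¹ * cantorProb {3 * x} + 2⁻¹ * cantorProb {3 * x - 2} := by
  conv_lhs => rw [cantorProb_eq]
  rw [Measure.add_apply, Measure.smul_apply, Measure.smul_apply,
    Measure.map_apply (by fun_prop) (measurableSet_singleton _),
    Measure.map_apply (by fun_prop) (measurableSet_singleton _)]
  congr 3 <;> ext y <;> simp <;> constructor <;> intro h <;> linarith

/-- The point 0 is fixed by x ↦ x/3, and its preimage -2 under the other branch is outside C; so the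
mass equals half of itself. For the point 1 the branches exchange roles. -/
theorem cantorProb_zero : cantorProb {0} = 0 := by
  refine eq_zero_of_eq_inv_two_mul (measure_ne_top _ _) ?_
  have h : cantorProb {(-2 : ℝ)} = 0 := cantorProb_singleton_of_notMem fun h => by
    have := (cantorSet_subset_unitInterval h).1
    norm_num at this
  simpa [h] using cantorProb_singleton 0

theorem cantorProb_one : cantorProb {1} = 0 := by
  refine eq_zero_of_eq_inv_two_mul (measure_ne_top _ _) ?_
  have h : cantorProb {(3 : ℝ)} = 0 := cantorProb_singleton_of_notMem fun h => by
    have := (cantorSet_subset_unitInterval h).2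
    norm_num at this
  have := cantorProb_singleton 1
  norm_num [h] at this
  simpa using this

/-! ### Copies of the Cantor probability measure -/

theorem copyMeasure_apply (n : ℕ) (k : ℤ) {A : Set ℝ} (hA : MeasurableSet A) :
    copyMeasure n k A =
      2⁻¹ ^ n * cantorProb ((fun x : ℝ => (3 : ℝ) ^ (-(n : ℤ)) * (x + k)) ⁻¹' A) := by
  rw [copyMeasure, Measure.smul_apply, Measure.map_apply (by fun_prop) hA, smul_eq_mul]

theorem copyMeasure_translate (n : ℕ) (k m : ℤ) {A : Set ℝ} (hA : MeasurableSet A) :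
    copyMeasure n k ((fun x => x + (m : ℝ)) ⁻¹' A) = copyMeasure n (k + 3 ^ n * m) A := by
  rw [copyMeasure_apply _ _ hA, copyMeasure_apply _ _ (hA.preimage (by fun_prop)), ← preimage_comp]
  congr 3
  ext x
  simp
  field_simp
  ring

theorem copyMeasure_third (n : ℕ) (k : ℤ) {A : Set ℝ} (hA : MeasurableSet A) :
    copyMeasure n k ((fun x => (3 : ℝ)⁻¹ * x) ⁻¹' A) = 2 * copyMeasure (n + 1) k A := by
  rw [copyMeasure_apply _ _ hA, copyMeasure_apply _ _ (hA.preimage (by fun_prop)), ← preimage_comp,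
    ← mul_assoc, pow_succ', ← mul_assoc 2, ENNReal.mul_inv_cancel (by simp) (by simp), one_mul]
  congr 3
  ext x
  simp only [Function.comp_apply, zpow_neg, zpow_natCast, pow_succ]
  field_simp

theorem copyMeasure_split (n : ℕ) (k : ℤ) {A : Set ℝ} (hA : MeasurableSet A) :
    copyMeasure n k A = copyMeasure (n + 1) (3 * k) A + copyMeasure (n + 1) (3 * k + 2) A := by
  have h : MeasurableSet ((fun x : ℝ => (3 : ℝ) ^ (-(n : ℤ)) * (x + k)) ⁻¹' A) :=
    hA.preimage (by fun_prop)
  rw [copyMeasure_apply _ _ hA, copyMeasure_apply _ _ hA, copyMeasure_apply _ _ hA]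
  conv_lhs => rw [cantorProb_eq]
  rw [Measure.add_apply, Measure.smul_apply, Measure.smul_apply,
    Measure.map_apply (by fun_prop) h, Measure.map_apply (by fun_prop) h, ← preimage_comp,
    ← preimage_comp, mul_add, smul_eq_mul, smul_eq_mul, ← mul_assoc, ← mul_assoc, ← pow_succ]
  congr 4 <;> ext x <;> simp only [Function.comp_apply, zpow_neg, zpow_natCast, pow_succ] <;>
    (push_cast; field_simp <;> ring)

theorem filledCantorMeasureReal_apply {A : Set ℝ} (hA : MeasurableSet A) :
    filledCantorMeasureReal A = ∑' k : ℤ, copyMeasure 0 k A +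
      ∑' (n : ℕ) (k : ℤ), copyMeasure (n + 1) (3 * k + 1) A := by
  rw [filledCantorMeasureReal, Measure.add_apply, Measure.sum_apply _ hA, Measure.sum_apply _ hA,
    ENNReal.tsum_prod']

/-- At level n+1 the translation adds 3ⁿ⁺¹m to the index, which preserves the residue 1 modulo 3;
each sum is merely reindexed. -/
theorem filledCantorMeasureReal_translate (m : ℤ) :
    filledCantorMeasureReal.map (fun x => x + (m : ℝ)) = filledCantorMeasureReal := by
  ext A hA
  rw [Measure.map_apply (by fun_prop) hA, filledCantorMeasureReal_apply hA,
    filledCantorMeasureReal_apply (hA.preimage (by fun_prop))]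
  simp only [copyMeasure_translate _ _ _ hA]
  congr 1
  · exact (Equiv.addRight (3 ^ 0 * m)).tsum_eq fun k => copyMeasure 0 k A
  · refine tsum_congr fun n => ?_
    rw [← (Equiv.addRight (3 ^ n * m)).tsum_eq fun k => copyMeasure (n + 1) (3 * k + 1) A]
    refine tsum_congr fun k => ?_
    congr 2
    simp only [Equiv.coe_addRight]
    ring

theorem tsum_int_eq_tsum_three (g : ℤ → ℝ≥0∞) :
    ∑' k, g k = ∑' k, (g (3 * k) + g (3 * k + 2)) + ∑' k, g (3 * k + 1) := by
  rw [← (Int.divModEquiv 3).symm.tsum_eq g, ENNReal.tsum_prod', ← ENNReal.tsum_add]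
  refine tsum_congr fun k => ?_
  rw [tsum_fintype, Fin.sum_univ_three]
  simp [Int.divModEquiv, mul_comm]
  ring

theorem filledCantorMeasureReal_third :
    filledCantorMeasureReal.map (fun x => (3 : ℝ)⁻¹ * x) = (2 : ℝ≥0∞) • filledCantorMeasureReal := by
  ext A hA
  rw [Measure.map_apply (by fun_prop) hA, Measure.smul_apply, filledCantorMeasureReal_apply hA,
    filledCantorMeasureReal_apply (hA.preimage (by fun_prop)), smul_eq_mul]
  simp only [copyMeasure_third _ _ hA, ENNReal.tsum_mul_left, ← mul_add]
  congr 1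
  -- The contraction sends the level 0 sum to a sum over all indices of level 1: residues 0 and 2
  -- recombine into level 0, and residue 1 supplies the missing n = 0 term of the middle sums.
  rw [tsum_int_eq_tsum_three,
    tsum_eq_zero_add' (f := fun n : ℕ => ∑' k : ℤ, copyMeasure (n + 1) (3 * k + 1) A)
      ENNReal.summable, ← add_assoc]
  congr 2
  exact tsum_congr fun k => (copyMeasure_split 0 k hA).symm

/-! ### Null overlaps between C and other copies; normalization -/

theorem exists_mul_pow_eq (p : ℕ) {c : ℝ} (hc : c ∈ cantorSet) :
    ∃ c' ∈ cantorSet, ∃ k : ℤ, (3 : ℝ) ^ p * c = c' + k := by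
  induction p generalizing c with
  | zero => exact ⟨c, hc, 0, by simp⟩
  | succ p ih =>
    rw [cantorSet_eq_union_halves] at hc
    rcases hc with ⟨d, hd, rfl⟩ | ⟨d, hd, rfl⟩
    · obtain ⟨c', hc', k, h⟩ := ih hd
      exact ⟨c', hc', k, by rw [← h, pow_succ]; ring⟩
    · obtain ⟨c', hc', k, h⟩ := ih hd
      refine ⟨c', hc', k + 3 ^ p * 2, ?_⟩
      push_cast
      rw [← add_assoc, ← h, pow_succ]
      ring

/-- After multiplication by 3ⁿ, c differs from a point of C by an integer not divisible by 3. Both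
points lie in [0,1], so the integer is ±1 and c is an endpoint. -/
theorem mem_endpoints {n : ℕ} {k : ℤ} {c : ℝ} (hc : c ∈ cantorSet)
    (h : (3 : ℝ) ^ (-((n + 1 : ℕ) : ℤ)) * (c + (3 * k + 1 : ℤ)) ∈ cantorSet) :
    c ∈ ({0, 1} : Set ℝ) := by
  obtain ⟨c', hc', m, e⟩ := exists_mul_pow_eq n h
  have e' : c + (3 * k + 1) = 3 * c' + 3 * m := by
    rw [zpow_neg, zpow_natCast, pow_succ] at e
    push_cast at e
    field_simp at e
    linarith
  obtain ⟨h0, h1⟩ := cantorSet_subset_unitInterval hc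
  rw [cantorSet_eq_union_halves] at hc'
  rcases hc' with ⟨d, hd, rfl⟩ | ⟨d, hd, rfl⟩ <;>
    obtain ⟨d0, d1⟩ := cantorSet_subset_unitInterval hd
  · have e2 : c = d + ((3 * m - 3 * k - 1 : ℤ) : ℝ) := by push_cast; linarith
    have l0 : -1 ≤ 3 * m - 3 * k - 1 := by
      exact_mod_cast (by linarith : (-1 : ℝ) ≤ ((3 * m - 3 * k - 1 : ℤ) : ℝ))
    have l1 : 3 * m - 3 * k - 1 ≤ 1 := by
      exact_mod_cast (by linarith : ((3 * m - 3 * k - 1 : ℤ) : ℝ) ≤ 1)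
    rw [show 3 * m - 3 * k - 1 = -1 by omega] at e2
    push_cast at e2
    left; linarith
  · have e2 : c = d + ((3 * m - 3 * k + 1 : ℤ) : ℝ) := by push_cast; linarith
    have l0 : -1 ≤ 3 * m - 3 * k + 1 := by
      exact_mod_cast (by linarith : (-1 : ℝ) ≤ ((3 * m - 3 * k + 1 : ℤ) : ℝ))
    have l1 : 3 * m - 3 * k + 1 ≤ 1 := by
      exact_mod_cast (by linarith : ((3 * m - 3 * k + 1 : ℤ) : ℝ) ≤ 1)
    rw [show 3 * m - 3 * k + 1 = 1 by omega] at e2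
    push_cast at e2
    right; simp; linarith

theorem mem_endpoints_of_add_int {k : ℤ} (hk : k ≠ 0) {c : ℝ} (hc : c ∈ cantorSet)
    (h : c + k ∈ cantorSet) : c ∈ ({0, 1} : Set ℝ) := by
  obtain ⟨h0, h1⟩ := cantorSet_subset_unitInterval hc
  obtain ⟨h2, h3⟩ := cantorSet_subset_unitInterval h
  have l0 : -1 ≤ k := by exact_mod_cast (by linarith : (-1 : ℝ) ≤ k)
  have l1 : k ≤ 1 := by exact_mod_cast (by linarith : (k : ℝ) ≤ 1)
  obtain rfl | rfl : k = -1 ∨ k = 1 := by omega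
  · right
    push_cast at h2
    simp; linarith
  · left
    push_cast at h3
    linarith

theorem cantorProb_null_of_endpoints {A : Set ℝ} (h : ∀ c ∈ cantorSet, c ∈ A → c ∈ ({0, 1} : Set ℝ)) :
    cantorProb A = 0 := by
  refine measure_mono_null (t := cantorSetᶜ ∪ ({0} ∪ {1})) (fun c hc => ?_) ?_
  · by_cases h' : c ∈ cantorSet
    · exact Or.inr (h c h' hc)
    · exact Or.inl h'
  · exact measure_union_null cantorProb_compl (measure_union_null cantorProb_zero cantorProb_one)

theorem filledCantorMeasureReal_cantorSet : filledCantorMeasureReal cantorSet = 1 := by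
  rw [filledCantorMeasureReal_apply isClosed_cantorSet.measurableSet]
  have h1 : ∀ (n : ℕ) (k : ℤ), copyMeasure (n + 1) (3 * k + 1) cantorSet = 0 := fun n k => by
    rw [copyMeasure_apply _ _ isClosed_cantorSet.measurableSet]
    exact mul_eq_zero_of_right _ (cantorProb_null_of_endpoints fun c hc h => mem_endpoints hc h)
  rw [tsum_eq_single 0]
  · simp only [h1, tsum_zero, add_zero]
    rw [copyMeasure_apply _ _ isClosed_cantorSet.measurableSet]
    simpa using (prob_compl_eq_zero_iff isClosed_cantorSet.measurableSet).1 cantorProb_compl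
  · intro k hk
    rw [copyMeasure_apply _ _ isClosed_cantorSet.measurableSet,
      cantorProb_null_of_endpoints fun c hc h => mem_endpoints_of_add_int hk hc (by simpa using h),
      mul_zero]

/-! ### Transfer of the measure from the line to R -/

theorem isCompact_cantorCopy (n k : ℤ) : IsCompact (cantorCopy n k) :=
  isCompact_cantorSet.image (by fun_prop)

theorem measurableSet_cantorCopy (n k : ℤ) : MeasurableSet (cantorCopy n k) :=
  (isCompact_cantorCopy n k).isClosed.measurableSet

theorem measurableSet_filledCantorSet : MeasurableSet filledCantorSet :=
  .iUnion fun n => .iUnion fun k => measurableSet_cantorCopy n k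

theorem copyMeasure_compl (n : ℕ) (k : ℤ) : copyMeasure n k filledCantorSetᶜ = 0 := by
  rw [copyMeasure_apply _ _ measurableSet_filledCantorSet.compl,
    cantorProb_null_of_endpoints fun c hc h => (h (mem_filledCantorSet.2 ⟨n, k, c, hc, rfl⟩)).elim,
    mul_zero]

theorem filledCantorMeasureReal_compl : filledCantorMeasureReal filledCantorSetᶜ = 0 := by
  simp [filledCantorMeasureReal_apply measurableSet_filledCantorSet.compl, copyMeasure_compl]

theorem measurableEmbedding_val :
    MeasurableEmbedding (Subtype.val : filledCantorSet → ℝ) :=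
  .subtype_coe measurableSet_filledCantorSet

theorem map_val_filledCantorMeasure :
    filledCantorMeasure.map Subtype.val = filledCantorMeasureReal := by
  rw [filledCantorMeasure, measurableEmbedding_val.map_comap, Subtype.range_coe]
  exact Measure.restrict_eq_self_of_ae_mem (measure_eq_zero_iff_ae_notMem.1
    filledCantorMeasureReal_compl |>.mono fun x hx => by simpa using hx)

theorem measure_ext_map_val {ν ν' : Measure filledCantorSet}
    (h : ν.map Subtype.val = ν'.map Subtype.val) : ν = ν' := by
  rw [← measurableEmbedding_val.comap_map ν, h, measurableEmbedding_val.comap_map]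

theorem measurable_translate (m : ℤ) : Measurable (translate m) :=
  (measurable_subtype_coe.add_const _).subtype_mk

theorem measurable_third : Measurable third :=
  (measurable_subtype_coe.const_mul _).subtype_mk

/-- A measure on `R` with `ν C = 1` that is invariant under integer translations and doubled by
the push-forward along the contraction `x ↦ 3⁻¹ x`. -/
structure IsSelfSimilar (ν : Measure filledCantorSet) : Prop where
  measure_cantorSet : ν {x | (x : ℝ) ∈ cantorSet} = 1
  map_translate : ∀ m : ℤ, ν.map (translate m) = ν
  map_third : ν.map third = (2 : ℝ≥0∞) • ν

theorem isSelfSimilar_filledCantorMeasure : IsSelfSimilar filledCantorMeasure where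
  measure_cantorSet := by
    rw [← filledCantorMeasureReal_cantorSet, ← map_val_filledCantorMeasure,
      Measure.map_apply measurable_subtype_coe isClosed_cantorSet.measurableSet]
    rfl
  map_translate m := by
    refine measure_ext_map_val ?_
    rw [Measure.map_map measurable_subtype_coe (measurable_translate m),
      map_val_filledCantorMeasure, ← filledCantorMeasureReal_translate m,
      ← map_val_filledCantorMeasure, Measure.map_map (by fun_prop) measurable_subtype_coe]
    rfl
  map_third := by
    refine measure_ext_map_val ?_
    rw [Measure.map_map measurable_subtype_coe measurable_third, Measure.map_smul,
      map_val_filledCantorMeasure, ← filledCantorMeasureReal_third,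
      ← map_val_filledCantorMeasure, Measure.map_map (by fun_prop) measurable_subtype_coe]
    rfl

/-! ### Self-similar measures and the defining properties of `ν` -/

theorem IsCantorMeasure.isSelfSimilar {ν : Measure filledCantorSet} (h : IsCantorMeasure ν) :
    IsSelfSimilar ν where
  measure_cantorSet := h.measure_cantorSet
  map_translate m := (h.invariant m).map_eq
  map_third := by
    have := h.sigmaFinite
    have key : ∀ A, MeasurableSet A → ν A < ∞ → ν (third ⁻¹' A) = 2 * ν A := by
      -- The dilation axiom concerns integrable functions only, so it yields the doubling for sets
      -- of finite measure; σ-finiteness extends it to all.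
      intro A hA hfin
      have hA' : MeasurableSet (third ⁻¹' A) := measurable_third hA
      obtain ⟨hi, he⟩ := h.dilation (A.indicator fun _ => 1)
        ((integrable_indicator_iff hA).2 (integrableOn_const (C := (1 : ℂ)) hfin.ne))
      have hc : (fun x => A.indicator (fun _ => (1 : ℂ)) (third x)) =
          (third ⁻¹' A).indicator fun _ => 1 := rfl
      rw [hc] at hi he
      rw [integral_indicator_const _ hA, integral_indicator_const _ hA'] at he
      simp only [Complex.real_smul, mul_one] at he
      have hfin' : ν (third ⁻¹' A) ≠ ∞ := by
        have := (integrable_indicator_iff hA').1 hi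
        have h2 : IntegrableOn (fun _ => (1 : ℂ)) (third ⁻¹' A) ν := this
        rw [integrableOn_const_iff] at h2
        exact (by simpa using h2 : ν (third ⁻¹' A) < ∞).ne
      have he' : ν.real A = 2⁻¹ * ν.real (third ⁻¹' A) := by
        apply Complex.ofReal_injective
        push_cast
        exact he
      rw [← ENNReal.toReal_eq_toReal_iff' hfin' (ENNReal.mul_ne_top (by simp) hfin.ne),
        ENNReal.toReal_mul]
      simp only [measureReal_def] at he'
      rw [he']
      simp
    refine (Measure.ext_iff_of_iUnion_eq_univ (iUnion_spanningSets ν)).2 fun i => ?_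
    ext A hA
    have hS := measurableSet_spanningSets ν i
    rw [Measure.restrict_apply hA, Measure.restrict_apply hA,
      Measure.map_apply measurable_third (hA.inter hS), Measure.smul_apply, smul_eq_mul]
    exact key _ (hA.inter hS)
      ((measure_mono inter_subset_right).trans_lt (measure_spanningSets_lt_top ν i))

/-! ### Copies of the Cantor set -/

/-- The copy `3⁻ⁿ (C + k)` as a subset of `R`. -/
def copySet (n k : ℤ) : Set filledCantorSet := {x | (x : ℝ) ∈ cantorCopy n k}

theorem measurableSet_copySet (n k : ℤ) : MeasurableSet (copySet n k) :=
  measurable_subtype_coe (measurableSet_cantorCopy n k)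

theorem mem_cantorCopy {n k : ℤ} {x : ℝ} :
    x ∈ cantorCopy n k ↔ (3 : ℝ) ^ n * x - k ∈ cantorSet := by
  constructor
  · rintro ⟨c, hc, rfl⟩
    rw [← mul_assoc, ← zpow_add₀ (by norm_num)]
    simpa using hc
  · intro h
    refine ⟨_, h, ?_⟩
    simp only [sub_add_cancel]
    rw [← mul_assoc, ← zpow_add₀ (by norm_num)]
    simp

theorem mem_copySet {n k : ℤ} {x : filledCantorSet} :
    x ∈ copySet n k ↔ (3 : ℝ) ^ n * x - k ∈ cantorSet := mem_cantorCopy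

theorem mem_cantorSet_iff {c : ℝ} :
    c ∈ cantorSet ↔ 3 * c ∈ cantorSet ∨ 3 * c - 2 ∈ cantorSet := by
  conv_lhs => rw [cantorSet_eq_union_halves]
  refine or_congr ⟨?_, fun h => ⟨_, h, by ring⟩⟩ ⟨?_, fun h => ⟨_, h, by ring⟩⟩
  · rintro ⟨d, hd, rfl⟩
    simpa [mul_div_cancel₀] using hd
  · rintro ⟨d, hd, rfl⟩
    simpa [mul_div_cancel₀] using hd

theorem copySet_eq_union (n k : ℤ) :
    copySet n k = copySet (n + 1) (3 * k) ∪ copySet (n + 1) (3 * k + 2) := by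
  ext x
  simp only [mem_union, mem_copySet]
  rw [mem_cantorSet_iff, zpow_add_one₀ (by norm_num)]
  push_cast
  ring_nf

theorem iUnion_copySet : ⋃ p : ℤ × ℤ, copySet p.1 p.2 = univ := by
  refine eq_univ_of_forall fun x => ?_
  obtain ⟨n, k, c, hc, hx⟩ := mem_filledCantorSet.1 x.2
  exact mem_iUnion.2 ⟨(n, k), c, hc, hx⟩

theorem exists_mem_copySet_add {m l : ℤ} {x : filledCantorSet} (hx : x ∈ copySet m l) (d : ℕ) :
    ∃ l', x ∈ copySet (m + d) l' := by
  induction d with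
  | zero => exact ⟨l, by simpa using hx⟩
  | succ d ih =>
    obtain ⟨l', h⟩ := ih
    rw [copySet_eq_union] at h
    push_cast
    rw [← add_assoc]
    exact h.elim (fun h => ⟨_, h⟩) fun h => ⟨_, h⟩

/-- The triadic rationals in `R`. -/
def triadicPoints : Set filledCantorSet := ⋃ p : ℤ × ℤ, {x | (3 : ℝ) ^ p.1 * x = p.2}

theorem measurableSet_eq_int (n k : ℤ) :
    MeasurableSet {x : filledCantorSet | (3 : ℝ) ^ n * x = k} :=
  measurableSet_eq_fun (measurable_subtype_coe.const_mul _) measurable_const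

theorem mem_triadicPoints {n k : ℤ} {x : filledCantorSet} (h : (3 : ℝ) ^ n * x = k) :
    x ∈ triadicPoints := mem_iUnion.2 ⟨(n, k), h⟩

theorem bounds_of_mem_copySet {n k : ℤ} {x : filledCantorSet} (h : x ∈ copySet n k) :
    (k : ℝ) ≤ 3 ^ n * x ∧ (3 : ℝ) ^ n * x ≤ k + 1 := by
  obtain ⟨h0, h1⟩ := cantorSet_subset_unitInterval (mem_copySet.1 h)
  constructor <;> linarith

theorem copySet_inter_subset {n k l : ℤ} (hkl : k ≠ l) :
    copySet n k ∩ copySet n l ⊆ triadicPoints := by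
  wlog h : k < l generalizing k l
  · rw [inter_comm]
    exact this hkl.symm (by omega)
  rintro x ⟨hk, hl⟩
  have h1 := (bounds_of_mem_copySet hk).2
  have h2 := (bounds_of_mem_copySet hl).1
  have h3 : (k : ℝ) + 1 ≤ l := by exact_mod_cast h
  exact mem_triadicPoints (le_antisymm (by linarith) h2)

/-- Refining the coarser copy down to level n+1 uses only indices congruent to 0 or 2 modulo 3, and
distinct copies of one level share at most an endpoint. -/
theorem copySet_inter_middle_subset {m n : ℤ} (hmn : m ≤ n) (l k : ℤ) :
    copySet m l ∩ copySet (n + 1) (3 * k + 1) ⊆ triadicPoints := by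
  obtain ⟨d, rfl⟩ := Int.le.dest hmn
  rintro x ⟨hx, hx'⟩
  obtain ⟨l', h⟩ := exists_mem_copySet_add hx d
  rw [copySet_eq_union] at h
  rcases h with h | h <;> exact copySet_inter_subset (by omega) ⟨h, hx'⟩

/-- Up to triadic points the copies are nested or disjoint, like dyadic intervals. -/
theorem copySet_subset_or_inter_subset {m n : ℤ} (hmn : m ≤ n) (l k : ℤ) :
    copySet n k ⊆ copySet m l ∨ copySet m l ∩ copySet n k ⊆ triadicPoints := by
  obtain ⟨d, rfl⟩ := Int.le.dest hmn
  clear hmn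
  induction d generalizing k with
  | zero =>
    by_cases h : k = l
    · left; simp [h]
    · right; simpa using copySet_inter_subset (Ne.symm h)
  | succ d ih =>
    push_cast
    rw [← add_assoc]
    obtain ⟨q, rfl | rfl | rfl⟩ : ∃ q, k = 3 * q ∨ k = 3 * q + 1 ∨ k = 3 * q + 2 :=
      ⟨k / 3, by omega⟩
    · have h : copySet (m + d + 1) (3 * q) ⊆ copySet (m + d) q := by
        rw [copySet_eq_union (m + d)]; exact subset_union_left
      exact (ih q).imp h.trans fun h' => (inter_subset_inter_right _ h).trans h'
    · exact Or.inr (copySet_inter_middle_subset (by omega) _ _)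
    · have h : copySet (m + d + 1) (3 * q + 2) ⊆ copySet (m + d) q := by
        rw [copySet_eq_union (m + d)]; exact subset_union_right
      exact (ih q).imp h.trans fun h' => (inter_subset_inter_right _ h).trans h'

/-! ### Masses forced by self-similarity -/

namespace IsSelfSimilar

variable {ν : Measure filledCantorSet} (h : IsSelfSimilar ν)
include h

theorem measure_preimage_third {A : Set filledCantorSet} (hA : MeasurableSet A) :
    ν (third ⁻¹' A) = 2 * ν A := by
  rw [← Measure.map_apply measurable_third hA, h.map_third, Measure.smul_apply, smul_eq_mul]

theorem measure_preimage_translate (m : ℤ) {A : Set filledCantorSet} (hA : MeasurableSet A) :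
    ν (translate m ⁻¹' A) = ν A := by
  rw [← Measure.map_apply (measurable_translate m) hA, h.map_translate]

theorem measure_copySet_zero (k : ℤ) : ν (copySet 0 k) = 1 := by
  rw [← h.measure_cantorSet, ← h.measure_preimage_translate k (measurableSet_copySet 0 k)]
  congr 1
  ext x
  simp [mem_copySet, translate]

theorem measure_copySet_succ (n k : ℤ) : ν (copySet n k) = 2 * ν (copySet (n + 1) k) := by
  rw [← h.measure_preimage_third (measurableSet_copySet _ _)]
  congr 1
  ext x
  simp only [mem_copySet, third, mem_preimage]
  rw [zpow_add_one₀ (by norm_num)]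
  field_simp

theorem measure_copySet (n k : ℤ) : ν (copySet n k) = ENNReal.ofReal (2 ^ (-n)) := by
  induction n with
  | zero => simpa using h.measure_copySet_zero k
  | succ n ih =>
    rw [h.measure_copySet_succ] at ih
    refine (ENNReal.mul_right_inj (a := 2) (by simp) (by simp)).1 (ih.trans ?_)
    rw [← ENNReal.ofReal_ofNat 2, ← ENNReal.ofReal_mul (by norm_num), neg_add, zpow_add₀ (by norm_num)]
    congr 1
    norm_num
    ring
  | pred n ih =>
    rw [h.measure_copySet_succ, sub_add_cancel, ih, ← ENNReal.ofReal_ofNat 2,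
      ← ENNReal.ofReal_mul (by norm_num), neg_sub, sub_eq_add_neg, zpow_add₀ (by norm_num)]
    simp

theorem measure_copySet_ne_top (n k : ℤ) : ν (copySet n k) ≠ ∞ := by
  simp [h.measure_copySet]

theorem measureReal_copySet (n k : ℤ) : ν.real (copySet n k) = 2 ^ (-n) := by
  rw [measureReal_def, h.measure_copySet, ENNReal.toReal_ofReal (by positivity)]

theorem measure_eq_int_succ (n k : ℤ) :
    ν {x | (3 : ℝ) ^ n * x = k} = 2 * ν {x | (3 : ℝ) ^ (n + 1) * x = k} := by
  rw [← h.measure_preimage_third (measurableSet_eq_int _ _)]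
  congr 1
  ext x
  simp only [third, mem_preimage, mem_ofPred_eq]
  rw [zpow_add_one₀ (by norm_num)]
  field_simp

theorem measure_eq_int_zero (k : ℤ) : ν {x | (3 : ℝ) ^ (0 : ℤ) * x = k} = 0 := by
  -- The contraction fixes 0, so the mass of this point is twice itself; it is finite because 0 lies
  -- in C. Translations carry the result to every integer.
  have h0 : ν {x | (3 : ℝ) ^ (0 : ℤ) * x = (0 : ℤ)} = 0 := by
    have h1 := h.measure_eq_int_succ 0 0
    have h2 : {x : filledCantorSet | (3 : ℝ) ^ (0 + 1 : ℤ) * x = (0 : ℤ)} =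
        {x : filledCantorSet | (3 : ℝ) ^ (0 : ℤ) * x = (0 : ℤ)} := by
      ext x; simp
    rw [h2] at h1
    refine eq_zero_of_eq_inv_two_mul ?_ ?_
    · have hsub : {x : filledCantorSet | (3 : ℝ) ^ (0 : ℤ) * x = (0 : ℤ)} ⊆ copySet 0 0 := ?_
      · exact measure_ne_top_of_subset hsub (h.measure_copySet_ne_top 0 0)
      intro x hx
      have : (x : ℝ) = 0 := by simpa using hx
      simpa [mem_copySet, this] using zero_mem_cantorSet
    · conv_rhs => rw [h1]
      rw [← mul_assoc, ENNReal.inv_mul_cancel (by simp) (by simp), one_mul]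
  rw [← h0, ← h.measure_preimage_translate k (measurableSet_eq_int 0 k)]
  congr 1
  ext x
  simp [translate]

theorem measure_triadicPoints : ν triadicPoints = 0 := by
  refine measure_iUnion_null fun p => ?_
  obtain ⟨n, k⟩ := p
  change ν {x | (3 : ℝ) ^ n * x = k} = 0
  induction n with
  | zero => exact h.measure_eq_int_zero k
  | succ n ih =>
    rw [h.measure_eq_int_succ] at ih
    exact (mul_eq_zero.1 ih).resolve_left (by simp)
  | pred n ih => rw [h.measure_eq_int_succ, sub_add_cancel, ih, mul_zero]

theorem sigmaFinite : SigmaFinite ν := by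
  refine Measure.sigmaFinite_of_countable
    (countable_range fun p : ℤ × ℤ => copySet p.1 p.2) ?_ ?_
  · rintro _ ⟨p, rfl⟩
    exact (h.measure_copySet_ne_top _ _).lt_top
  · rw [sUnion_range, iUnion_copySet]

theorem isCantorMeasure : IsCantorMeasure ν where
  sigmaFinite := h.sigmaFinite
  measure_cantorSet := h.measure_cantorSet
  invariant m := ⟨measurable_translate m, h.map_translate m⟩
  dilation f hf := by
    have h2 : Integrable f (ν.map third) := by
      rw [h.map_third]
      exact hf.smul_measure (by simp)
    refine ⟨(integrable_map_measure h2.aestronglyMeasurable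
      measurable_third.aemeasurable).1 h2, ?_⟩
    rw [← integral_map measurable_third.aemeasurable h2.aestronglyMeasurable, h.map_third,
      integral_smul_measure]
    simp

end IsSelfSimilar

/-! ### An induction principle for measurable subsets of a copy -/

/-- Cut points start at level m so that, for a copy of level m, each one falls on the grid of that
level or of a finer one. -/
theorem generateFrom_triadic (m : ℤ) :
    borel ℝ = MeasurableSpace.generateFrom
      (range fun p : ℕ × ℤ => Iio ((3 : ℝ) ^ (-(m + p.1)) * p.2)) := by
  refine le_antisymm ?_ ?_
  · rw [borel_eq_generateFrom_Iio]
    refine MeasurableSpace.generateFrom_le ?_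
    rintro _ ⟨t, rfl⟩
    have ht : Iio t = ⋃ (p : ℕ × ℤ) (_ : (3 : ℝ) ^ (-(m + p.1)) * p.2 ≤ t),
        Iio ((3 : ℝ) ^ (-(m + p.1)) * p.2) := by
      ext x
      simp only [mem_Iio, mem_iUnion, exists_prop]
      refine ⟨fun hx => ?_, fun ⟨p, h1, h2⟩ => h2.trans_le h1⟩
      -- Chosen so that the mesh 3^(-(m+d)) is below t - x; the grid point given by the floor of
      -- 3^(m+d) t then lies in (x, t].
      obtain ⟨d, hd⟩ := exists_pow_lt_of_lt_one (show 0 < (t - x) * 3 ^ m by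
        have := sub_pos.2 hx; positivity) (show (3 : ℝ)⁻¹ < 1 by norm_num)
      have hpos : (0 : ℝ) < 3 ^ (m + d) := by positivity
      have h1 := Int.floor_le ((3 : ℝ) ^ (m + d) * t)
      have h2 := Int.lt_floor_add_one ((3 : ℝ) ^ (m + d) * t)
      refine ⟨(d, ⌊(3 : ℝ) ^ (m + d) * t⌋), ?_, ?_⟩
      · rw [zpow_neg, inv_mul_le_iff₀ hpos]
        exact h1
      · rw [zpow_neg, lt_inv_mul_iff₀ hpos]
        have h3 : 1 < (t - x) * 3 ^ (m + d) := by
          rw [zpow_add₀ (by norm_num), zpow_natCast, ← mul_assoc]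
          rwa [inv_pow, inv_lt_iff_one_lt_mul₀ (by positivity)] at hd
        linarith
    rw [ht]
    exact .iUnion fun p => .iUnion fun _ => MeasurableSpace.measurableSet_generateFrom ⟨p, rfl⟩
  · refine MeasurableSpace.generateFrom_le ?_
    rintro _ ⟨p, rfl⟩
    exact measurableSet_Iio

/-- A cut on the copy's own grid leaves all of it, up to an endpoint, or nothing. A cut d levels
deeper is handled by splitting the copy into its two halves, one level closer to the cut. -/
theorem inter_triadic_induction {P : Set filledCantorSet → Prop} {K : Set filledCantorSet}
    (empty : P ∅) (copy : ∀ n k, copySet n k ⊆ K → P (copySet n k))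
    (congr : ∀ A B, MeasurableSet A → MeasurableSet B → A \ triadicPoints = B \ triadicPoints →
      A ⊆ K → B ⊆ K → P A → P B)
    (union : ∀ A B, MeasurableSet A → MeasurableSet B → A ∩ B ⊆ triadicPoints →
      A ⊆ K → B ⊆ K → P A → P B → P (A ∪ B))
    {m l : ℤ} (hK : copySet m l ⊆ K) (d : ℕ) (j : ℤ) :
    P (copySet m l ∩ {x | (x : ℝ) < 3 ^ (-(m + d)) * j}) := by
  have hm' : ∀ m l a, MeasurableSet (copySet m l ∩ {x | (x : ℝ) < a}) := fun m l a =>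
    (measurableSet_copySet m l).inter (measurable_subtype_coe measurableSet_Iio)
  induction d generalizing m l with
  | zero =>
    have hpos : (0 : ℝ) < 3 ^ m := by positivity
    have hlt : ∀ x : ℝ, x < 3 ^ (-(m + (0 : ℕ))) * j ↔ 3 ^ m * x < j := fun x => by
      rw [Nat.cast_zero, add_zero, zpow_neg, lt_inv_mul_iff₀ hpos]
    rcases le_or_gt j l with hj | hj
    · convert empty
      refine eq_empty_of_forall_notMem fun x hx => ?_
      have h1 := (bounds_of_mem_copySet hx.1).1
      have h2 := (hlt x).1 hx.2
      have h3 : (j : ℝ) ≤ l := by exact_mod_cast hj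
      linarith
    · refine congr _ _ (measurableSet_copySet m l) (hm' _ _ _) ?_ hK
        (inter_subset_left.trans hK) (copy m l hK)
      ext x
      refine ⟨fun hx => ⟨⟨hx.1, (hlt x).2 ?_⟩, hx.2⟩, fun hx => ⟨hx.1.1, hx.2⟩⟩
      have h1 := (bounds_of_mem_copySet hx.1).2
      have h3 : (l : ℝ) + 1 ≤ j := by exact_mod_cast hj
      refine lt_of_le_of_ne (h1.trans h3) fun he => hx.2 (mem_triadicPoints he)
  | succ d ih =>
    have hsub := copySet_eq_union m l
    have h1 : copySet (m + 1) (3 * l) ⊆ K := subset_union_left.trans (hsub.symm.subset.trans hK)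
    have h2 : copySet (m + 1) (3 * l + 2) ⊆ K :=
      subset_union_right.trans (hsub.symm.subset.trans hK)
    have he : m + ((d + 1 : ℕ) : ℤ) = m + 1 + d := by push_cast; ring
    rw [hsub, union_inter_distrib_right, he]
    refine union _ _ (hm' _ _ _) (hm' _ _ _) ?_ (inter_subset_left.trans h1)
      (inter_subset_left.trans h2) (ih h1) (ih h2)
    exact (inter_subset_inter inter_subset_left inter_subset_left).trans
      (copySet_inter_subset (by omega))

/-- Dynkin's π-λ argument with triadic half-lines as the π-system. Working inside one copy keeps
masses finite and integrals convergent, as the complement step needs in both applications. -/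
theorem inter_copySet_induction {P : Set filledCantorSet → Prop} {m l : ℤ}
    (empty : P ∅) (copy : ∀ n k, copySet n k ⊆ copySet m l → P (copySet n k))
    (congr : ∀ A B, MeasurableSet A → MeasurableSet B → A \ triadicPoints = B \ triadicPoints →
      A ⊆ copySet m l → B ⊆ copySet m l → P A → P B)
    (union : ∀ A B, MeasurableSet A → MeasurableSet B → A ∩ B ⊆ triadicPoints →
      A ⊆ copySet m l → B ⊆ copySet m l → P A → P B → P (A ∪ B))
    (diff : ∀ A, MeasurableSet A → A ⊆ copySet m l → P A → P (copySet m l \ A))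
    (iUnion : ∀ A : ℕ → Set filledCantorSet, (∀ i, MeasurableSet (A i)) →
      Pairwise (Function.onFun Disjoint A) → (∀ i, A i ⊆ copySet m l) → (∀ i, P (A i)) →
      P (⋃ i, A i))
    {A : Set filledCantorSet} (hA : MeasurableSet A) : P (A ∩ copySet m l) := by
  have hK := measurableSet_copySet m l
  induction A, hA using MeasurableSpace.induction_on_inter
    (s := (preimage Subtype.val) '' range fun p : ℕ × ℤ => Iio ((3 : ℝ) ^ (-(m + p.1)) * p.2)) with
  | h_eq =>
    rw [← MeasurableSpace.comap_generateFrom, ← generateFrom_triadic m]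
    rfl
  | h_inter =>
    rintro _ ⟨_, ⟨p, rfl⟩, rfl⟩ _ ⟨_, ⟨q, rfl⟩, rfl⟩ -
    rw [← preimage_inter, Iio_inter_Iio]
    refine mem_image_of_mem _ ?_
    rcases min_choice ((3 : ℝ) ^ (-(m + p.1)) * p.2) ((3 : ℝ) ^ (-(m + q.1)) * q.2) with h | h
    · exact ⟨p, by simp only [h]⟩
    · exact ⟨q, by simp only [h]⟩
  | empty => simpa using empty
  | basic _ h =>
    obtain ⟨_, ⟨p, rfl⟩, rfl⟩ := h
    rw [inter_comm]
    exact inter_triadic_induction empty copy congr union subset_rfl p.1 p.2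
  | compl A hA ih =>
    have := diff _ (hA.inter hK) inter_subset_right ih
    rwa [inter_comm A, sdiff_self_inter, sdiff_eq, inter_comm] at this
  | iUnion f hd hm ih =>
    rw [iUnion_inter]
    exact iUnion _ (fun i => (hm i).inter hK)
      (fun i j hij => (hd hij).mono inter_subset_left inter_subset_left)
      (fun i => inter_subset_right) ih

theorem ae_eq_of_diff_triadicPoints {ν : Measure filledCantorSet} (h : IsSelfSimilar ν)
    {A B : Set filledCantorSet} (hAB : A \ triadicPoints = B \ triadicPoints) : A =ᵐ[ν] B := by
  have h1 := sdiff_null_ae_eq_self (s := A) h.measure_triadicPoints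
  have h2 := sdiff_null_ae_eq_self (s := B) h.measure_triadicPoints
  rw [← hAB] at h2
  exact h1.symm.trans h2

theorem IsSelfSimilar.eq {ν ν' : Measure filledCantorSet} (h : IsSelfSimilar ν)
    (h' : IsSelfSimilar ν') : ν = ν' := by
  refine (Measure.ext_iff_of_iUnion_eq_univ iUnion_copySet).2 fun p => ?_
  ext A hA
  rw [Measure.restrict_apply hA, Measure.restrict_apply hA]
  refine inter_copySet_induction (P := fun A => ν A = ν' A) (by simp) ?_ ?_ ?_ ?_ ?_ hA
  · intro n k _
    rw [h.measure_copySet, h'.measure_copySet]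
  · intro A B _ _ hAB _ _ he
    rw [← measure_congr (ae_eq_of_diff_triadicPoints h hAB),
      ← measure_congr (ae_eq_of_diff_triadicPoints h' hAB), he]
  · intro A B _ hB hAB _ _ hA' hB'
    rw [measure_union₀ hB.nullMeasurableSet (measure_mono_null hAB h.measure_triadicPoints),
      measure_union₀ hB.nullMeasurableSet (measure_mono_null hAB h'.measure_triadicPoints),
      hA', hB']
  · intro A hA hs he
    rw [measure_sdiff hs hA.nullMeasurableSet
        (measure_ne_top_of_subset hs (h.measure_copySet_ne_top _ _)),
      measure_sdiff hs hA.nullMeasurableSet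
        (measure_ne_top_of_subset hs (h'.measure_copySet_ne_top _ _)), he,
      h.measure_copySet, h'.measure_copySet]
  · intro A hm hd _ he
    rw [measure_iUnion hd hm, measure_iUnion hd hm]
    simp only [he]

/-! ### The wavelets as vectors of `L²` -/

theorem rpow_half_sq (j : ℤ) : ((2 : ℝ) ^ ((j : ℝ) / 2)) * ((2 : ℝ) ^ ((j : ℝ) / 2)) = 2 ^ j := by
  rw [← Real.rpow_add (by norm_num), add_halves, Real.rpow_intCast]

theorem sqrt_two_sq : ((2 : ℝ) ^ (1 / 2 : ℝ)) * ((2 : ℝ) ^ (1 / 2 : ℝ)) = 2 := by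
  rw [← Real.rpow_add (by norm_num)]
  norm_num

theorem mem_cantorCopy_one {j k l : ℤ} {x : filledCantorSet} :
    (3 : ℝ) ^ j * (x : ℝ) - k ∈ cantorCopy 1 l ↔ x ∈ copySet (j + 1) (3 * k + l) := by
  rw [mem_cantorCopy, mem_copySet, zpow_add_one₀ (by norm_num)]
  push_cast
  ring_nf

theorem indicator_cantorCopy_one (j k l : ℤ) (x : filledCantorSet) (c : ℂ) :
    (cantorCopy 1 l).indicator (fun _ => c) ((3 : ℝ) ^ j * (x : ℝ) - k) =
      (copySet (j + 1) (3 * k + l)).indicator (fun _ => c) x := by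
  by_cases hx : x ∈ copySet (j + 1) (3 * k + l)
  · rw [indicator_of_mem hx, indicator_of_mem (mem_cantorCopy_one.2 hx)]
  · rw [indicator_of_notMem hx, indicator_of_notMem fun h => hx (mem_cantorCopy_one.1 h)]

namespace IsSelfSimilar

variable {ν : Measure filledCantorSet} (h : IsSelfSimilar ν)

/-- The characteristic function of `3⁻ⁿ (C + k)` as a vector of `L²`. -/
noncomputable def chi (n k : ℤ) : Lp ℂ 2 ν :=
  indicatorConstLp 2 (measurableSet_copySet n k) (h.measure_copySet_ne_top n k) 1

/-- The wavelets as vectors of `L²`. -/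
noncomputable def wavelet : Fin 2 → ℤ → ℤ → Lp ℂ 2 ν :=
  ![fun j k => (((2 : ℝ) ^ ((j : ℝ) / 2) * (2 : ℝ) ^ (1 / 2 : ℝ) : ℝ) : ℂ) •
      h.chi (j + 1) (3 * k + 1),
    fun j k => (((2 : ℝ) ^ ((j : ℝ) / 2) : ℝ) : ℂ) •
      (h.chi (j + 1) (3 * k) - h.chi (j + 1) (3 * k + 2))]

theorem wavelet_zero (j k : ℤ) : h.wavelet 0 j k =
    (((2 : ℝ) ^ ((j : ℝ) / 2) * (2 : ℝ) ^ (1 / 2 : ℝ) : ℝ) : ℂ) •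
      h.chi (j + 1) (3 * k + 1) := rfl

theorem wavelet_one (j k : ℤ) : h.wavelet 1 j k = (((2 : ℝ) ^ ((j : ℝ) / 2) : ℝ) : ℂ) •
      (h.chi (j + 1) (3 * k) - h.chi (j + 1) (3 * k + 2)) := rfl

theorem coeFn_chi (n k : ℤ) : h.chi n k =ᵐ[ν] (copySet n k).indicator fun _ => 1 :=
  indicatorConstLp_coeFn

theorem coeFn_wavelet (i : Fin 2) (j k : ℤ) : h.wavelet i j k =ᵐ[ν] waveletFun i j k := by
  fin_cases i
  · change h.wavelet 0 j k =ᵐ[ν] waveletFun 0 j k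
    rw [wavelet_zero]
    filter_upwards [Lp.coeFn_smul (((2 : ℝ) ^ ((j : ℝ) / 2) * (2 : ℝ) ^ (1 / 2 : ℝ) : ℝ) : ℂ)
      (h.chi (j + 1) (3 * k + 1)), h.coeFn_chi (j + 1) (3 * k + 1)] with x h1 h2
    rw [h1, Pi.smul_apply, h2]
    change _ = (((2 : ℝ) ^ ((j : ℝ) / 2) : ℝ) : ℂ) * (cantorCopy 1 1).indicator
      (fun _ => (((2 : ℝ) ^ (1 / 2 : ℝ) : ℝ) : ℂ)) ((3 : ℝ) ^ j * (x : ℝ) - k)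
    rw [indicator_cantorCopy_one]
    by_cases hx : x ∈ copySet (j + 1) (3 * k + 1)
    · rw [indicator_of_mem hx, indicator_of_mem hx, smul_eq_mul, mul_one, Complex.ofReal_mul]
    · rw [indicator_of_notMem hx, indicator_of_notMem hx, smul_zero, mul_zero]
  · change h.wavelet 1 j k =ᵐ[ν] waveletFun 1 j k
    rw [wavelet_one]
    filter_upwards [Lp.coeFn_smul (((2 : ℝ) ^ ((j : ℝ) / 2) : ℝ) : ℂ)
      (h.chi (j + 1) (3 * k) - h.chi (j + 1) (3 * k + 2)),
      Lp.coeFn_sub (h.chi (j + 1) (3 * k)) (h.chi (j + 1) (3 * k + 2)),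
      h.coeFn_chi (j + 1) (3 * k), h.coeFn_chi (j + 1) (3 * k + 2)] with x h1 h2 h3 h4
    rw [h1, Pi.smul_apply, h2, Pi.sub_apply, h3, h4]
    change _ = (((2 : ℝ) ^ ((j : ℝ) / 2) : ℝ) : ℂ) *
      ((cantorCopy 1 0).indicator (fun _ => 1) ((3 : ℝ) ^ j * (x : ℝ) - k) -
        (cantorCopy 1 2).indicator (fun _ => 1) ((3 : ℝ) ^ j * (x : ℝ) - k))
    rw [indicator_cantorCopy_one, indicator_cantorCopy_one, add_zero, smul_eq_mul]

/-! ### Orthonormality -/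

theorem inner_chi (m l n k : ℤ) :
    inner ℂ (h.chi m l) (h.chi n k) = (ν.real (copySet m l ∩ copySet n k) : ℂ) :=
  L2.inner_indicatorConstLp_one_indicatorConstLp_one _ _ _ _

include h in
theorem measureReal_eq_zero {A : Set filledCantorSet} (hA : A ⊆ triadicPoints) :
    ν.real A = 0 := by
  rw [measureReal_def, measure_mono_null hA h.measure_triadicPoints, ENNReal.toReal_zero]

theorem inner_chi_self (n k : ℤ) : inner ℂ (h.chi n k) (h.chi n k) = (((2 : ℝ) ^ (-n) : ℝ) : ℂ) := by
  rw [inner_chi, inter_self, h.measureReal_copySet]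

theorem inner_chi_of_ne {n k l : ℤ} (hkl : k ≠ l) : inner ℂ (h.chi n k) (h.chi n l) = 0 := by
  rw [inner_chi, h.measureReal_eq_zero (copySet_inter_subset hkl), Complex.ofReal_zero]

theorem inner_chi_middle {m n : ℤ} (hmn : m ≤ n) (l k : ℤ) :
    inner ℂ (h.chi m l) (h.chi (n + 1) (3 * k + 1)) = 0 := by
  rw [inner_chi, h.measureReal_eq_zero (copySet_inter_middle_subset hmn l k), Complex.ofReal_zero]

/-- The two outer thirds of a level n copy either both lie in the coarser copy, with equal mass, or
both meet it in a null set. This makes the second wavelet orthogonal to coarser copies. -/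
theorem inner_chi_outer {m n : ℤ} (hmn : m ≤ n) (l k : ℤ) :
    inner ℂ (h.chi m l) (h.chi (n + 1) (3 * k)) =
      inner ℂ (h.chi m l) (h.chi (n + 1) (3 * k + 2)) := by
  have h1 : copySet (n + 1) (3 * k) ⊆ copySet n k := by
    rw [copySet_eq_union n]; exact subset_union_left
  have h2 : copySet (n + 1) (3 * k + 2) ⊆ copySet n k := by
    rw [copySet_eq_union n]; exact subset_union_right
  rw [inner_chi, inner_chi]
  rcases copySet_subset_or_inter_subset hmn l k with hs | hs
  · rw [inter_eq_self_of_subset_right (h1.trans hs), inter_eq_self_of_subset_right (h2.trans hs),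
      h.measureReal_copySet, h.measureReal_copySet]
  · rw [h.measureReal_eq_zero ((inter_subset_inter_right _ h1).trans hs),
      h.measureReal_eq_zero ((inter_subset_inter_right _ h2).trans hs)]

theorem inner_chi_wavelet {m j : ℤ} (hmj : m ≤ j) (l : ℤ) (i : Fin 2) (k : ℤ) :
    inner ℂ (h.chi m l) (h.wavelet i j k) = 0 := by
  fin_cases i
  · change inner ℂ _ (h.wavelet 0 j k) = 0
    rw [wavelet_zero, inner_smul_right, h.inner_chi_middle hmj, mul_zero]
  · change inner ℂ _ (h.wavelet 1 j k) = 0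
    rw [wavelet_one, inner_smul_right, inner_sub_right, h.inner_chi_outer hmj, sub_self, mul_zero]

/-- The wavelet of level j is a combination of copies of level j+1, which is at most j'. -/
theorem inner_wavelet_of_lt {j j' : ℤ} (hj : j < j') (i i' : Fin 2) (k k' : ℤ) :
    inner ℂ (h.wavelet i j k) (h.wavelet i' j' k') = 0 := by
  have hj' : j + 1 ≤ j' := hj
  fin_cases i
  · change inner ℂ (h.wavelet 0 j k) _ = 0
    rw [wavelet_zero, inner_smul_left, h.inner_chi_wavelet hj', mul_zero]
  · change inner ℂ (h.wavelet 1 j k) _ = 0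
    rw [wavelet_one, inner_smul_left, inner_sub_left, h.inner_chi_wavelet hj',
      h.inner_chi_wavelet hj', sub_self, mul_zero]

theorem inner_wavelet_zero_one (j k k' : ℤ) :
    inner ℂ (h.wavelet 0 j k) (h.wavelet 1 j k') = 0 := by
  rw [wavelet_zero, wavelet_one, inner_smul_left, inner_smul_right, inner_sub_right,
    h.inner_chi_of_ne (by omega), h.inner_chi_of_ne (by omega)]
  simp

theorem inner_wavelet_of_ne (i : Fin 2) (j : ℤ) {k k' : ℤ} (hk : k ≠ k') :
    inner ℂ (h.wavelet i j k) (h.wavelet i j k') = 0 := by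
  fin_cases i
  · change inner ℂ (h.wavelet 0 j k) (h.wavelet 0 j k') = 0
    rw [wavelet_zero, wavelet_zero, inner_smul_left, inner_smul_right,
      h.inner_chi_of_ne (by omega)]
    simp
  · change inner ℂ (h.wavelet 1 j k) (h.wavelet 1 j k') = 0
    rw [wavelet_one, wavelet_one, inner_smul_left, inner_smul_right, inner_sub_left,
      inner_sub_right, inner_sub_right, h.inner_chi_of_ne (by omega),
      h.inner_chi_of_ne (by omega), h.inner_chi_of_ne (by omega), h.inner_chi_of_ne (by omega)]
    simp

theorem inner_wavelet_self (i : Fin 2) (j k : ℤ) :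
    inner ℂ (h.wavelet i j k) (h.wavelet i j k) = 1 := by
  have h2 : (2 : ℝ) ^ j * 2 ^ (-(j + 1)) = 2⁻¹ := by
    rw [← zpow_add₀ (by norm_num)]; norm_num
  fin_cases i
  · change inner ℂ (h.wavelet 0 j k) (h.wavelet 0 j k) = 1
    rw [wavelet_zero, inner_smul_left, inner_smul_right, inner_chi_self, Complex.conj_ofReal]
    simp only [← Complex.ofReal_mul]
    rw [Complex.ofReal_eq_one]
    linear_combination (2 : ℝ) ^ (-(j + 1)) * 2 * rpow_half_sq j +
      (2 : ℝ) ^ ((j : ℝ) / 2) * (2 : ℝ) ^ ((j : ℝ) / 2) * 2 ^ (-(j + 1)) * sqrt_two_sq + 2 * h2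
  · change inner ℂ (h.wavelet 1 j k) (h.wavelet 1 j k) = 1
    rw [wavelet_one, inner_smul_left, inner_smul_right, inner_sub_left, inner_sub_right,
      inner_sub_right, inner_chi_self, inner_chi_self, h.inner_chi_of_ne (by omega),
      h.inner_chi_of_ne (by omega), Complex.conj_ofReal, sub_zero, zero_sub, sub_neg_eq_add]
    simp only [← Complex.ofReal_mul, ← Complex.ofReal_add]
    rw [Complex.ofReal_eq_one]
    linear_combination (2 : ℝ) ^ (-(j + 1)) * 2 * rpow_half_sq j + 2 * h2

theorem orthonormal_wavelet :
    Orthonormal ℂ fun p : Fin 2 × ℤ × ℤ => h.wavelet p.1 p.2.1 p.2.2 := by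
  refine ⟨fun p => ?_, ?_⟩
  · rw [norm_eq_sqrt_re_inner (𝕜 := ℂ), inner_wavelet_self]
    simp
  · rintro ⟨i, j, k⟩ ⟨i', j', k'⟩ hne
    change inner ℂ (h.wavelet i j k) (h.wavelet i' j' k') = 0
    rcases lt_trichotomy j j' with hj | rfl | hj
    · exact h.inner_wavelet_of_lt hj _ _ _ _
    · by_cases hi : i = i'
      · subst hi
        exact h.inner_wavelet_of_ne i j fun hk => hne (by rw [hk])
      · fin_cases i <;> fin_cases i'
        · exact (hi rfl).elim
        · exact h.inner_wavelet_zero_one _ _ _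
        · exact inner_eq_zero_symm.1 (h.inner_wavelet_zero_one _ _ _)
        · exact (hi rfl).elim
    · exact inner_eq_zero_symm.1 (h.inner_wavelet_of_lt hj _ _ _ _)

/-! ### Completeness -/

theorem chi_split (n k : ℤ) :
    h.chi n k = h.chi (n + 1) (3 * k) + h.chi (n + 1) (3 * k + 2) := by
  refine Lp.ext ?_
  filter_upwards [Lp.coeFn_add (h.chi (n + 1) (3 * k)) (h.chi (n + 1) (3 * k + 2)),
    h.coeFn_chi n k, h.coeFn_chi (n + 1) (3 * k), h.coeFn_chi (n + 1) (3 * k + 2),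
    measure_eq_zero_iff_ae_notMem.1 h.measure_triadicPoints] with x h1 h2 h3 h4 h5
  rw [h1, Pi.add_apply, h2, h3, h4, copySet_eq_union n,
    indicator_union_of_notMem_inter fun hx => h5 (copySet_inter_subset (by omega) hx)]

theorem norm_chi_sq (n k : ℤ) : ‖h.chi n k‖ ^ 2 = 2 ^ (-n) := by
  rw [← inner_self_eq_norm_sq (𝕜 := ℂ), inner_chi_self]
  exact Complex.ofReal_re _

theorem inner_chi_eq_zero {f : Lp ℂ 2 ν} (hf : ∀ i j k, inner ℂ (h.wavelet i j k) f = 0)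
    (n k : ℤ) : inner ℂ (h.chi n k) f = 0 := by
  have hmid : ∀ n k, inner ℂ (h.chi (n + 1) (3 * k + 1)) f = 0 := by
    intro n k
    have := hf 0 n k
    rw [wavelet_zero, inner_smul_left, Complex.conj_ofReal, mul_eq_zero] at this
    refine this.resolve_left ?_
    have : (0 : ℝ) < 2 ^ ((n : ℝ) / 2) * 2 ^ (1 / 2 : ℝ) := by positivity
    exact_mod_cast this.ne'
  have hout : ∀ n k, inner ℂ (h.chi (n + 1) (3 * k)) f =
      inner ℂ (h.chi (n + 1) (3 * k + 2)) f := by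
    intro n k
    have := hf 1 n k
    rw [wavelet_one, inner_smul_left, Complex.conj_ofReal, mul_eq_zero, inner_sub_left] at this
    refine sub_eq_zero.1 (this.resolve_left ?_)
    have : (0 : ℝ) < 2 ^ ((n : ℝ) / 2) := by positivity
    exact_mod_cast this.ne'
  have hsum : ∀ n k, inner ℂ (h.chi n k) f = 2 * inner ℂ (h.chi (n + 1) (3 * k)) f := by
    intro n k
    rw [chi_split, inner_add_left, ← hout, two_mul]
  -- The case d = 0 is Cauchy–Schwarz. Passing to the parent costs a factor 4 in the squared
  -- coefficient and only 2 in the squared norm, a gain of 2 per level.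
  have key : ∀ (d : ℕ) (n k : ℤ),
      ‖inner ℂ (h.chi n k) f‖ ^ 2 * 2 ^ d ≤ 2 ^ (-n) * ‖f‖ ^ 2 := by
    intro d
    induction d with
    | zero =>
      intro n k
      rw [← h.norm_chi_sq n k, pow_zero, mul_one, ← mul_pow]
      gcongr
      exact norm_inner_le_norm _ _
    | succ d ih =>
      intro n k
      have hpar : ∀ q, inner ℂ (h.chi n k) f = 2⁻¹ * inner ℂ (h.chi (n - 1) q) f →
          ‖inner ℂ (h.chi n k) f‖ ^ 2 * 2 ^ (d + 1) ≤ 2 ^ (-n) * ‖f‖ ^ 2 := by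
        intro q hq
        have := ih (n - 1) q
        rw [hq, norm_mul, mul_pow]
        rw [show -(n - 1) = -n + 1 by ring, zpow_add_one₀ (by norm_num)] at this
        rw [show ‖(2⁻¹ : ℂ)‖ = 2⁻¹ by simp, pow_succ _ d]
        linarith
      have hs := hsum (n - 1)
      have ho := hout (n - 1)
      have hm := hmid (n - 1)
      rw [sub_add_cancel] at hs ho hm
      -- Residues 0 and 2 are the halves of the parent copy q, carrying equal coefficients; residue
      -- 1 is a middle third, with coefficient 0.
      obtain ⟨q, rfl | rfl | rfl⟩ : ∃ q, k = 3 * q ∨ k = 3 * q + 1 ∨ k = 3 * q + 2 :=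
        ⟨k / 3, by omega⟩
      · exact hpar q (by rw [hs]; ring)
      · rw [hm, norm_zero, zero_pow two_ne_zero, zero_mul]
        positivity
      · exact hpar q (by rw [hs, ho]; ring)
  by_contra hne
  have hpos : 0 < ‖inner ℂ (h.chi n k) f‖ ^ 2 := pow_pos (norm_pos_iff.2 hne) 2
  obtain ⟨d, hd⟩ := pow_unbounded_of_one_lt
    (2 ^ (-n) * ‖f‖ ^ 2 / ‖inner ℂ (h.chi n k) f‖ ^ 2) (one_lt_two : (1 : ℝ) < 2)
  rw [div_lt_iff₀ hpos] at hd
  linarith [key d n k]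

/-- The coefficients are the integrals of f over copies. The induction principle spreads their
vanishing to all measurable subsets of a copy, where f is integrable, and countably many copies
cover R. -/
theorem eq_zero_of_inner_chi {f : Lp ℂ 2 ν} (hf : ∀ n k, inner ℂ (h.chi n k) f = 0) : f = 0 := by
  have hf' : ∀ n k, ∫ x in copySet n k, f x ∂ν = 0 := fun n k => by
    rw [← hf n k]
    exact (L2.inner_indicatorConstLp_one _ _ f).symm
  rw [Lp.eq_zero_iff_ae_eq_zero]
  suffices hae : f =ᵐ[ν.restrict (⋃ p : ℤ × ℤ, copySet p.1 p.2)] 0 by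
    rwa [iUnion_copySet, Measure.restrict_univ] at hae
  refine (ae_restrict_iUnion_iff _ _).2 fun p => ?_
  have hK : IntegrableOn f (copySet p.1 p.2) ν :=
    integrableOn_Lp_of_measure_ne_top f Fact.out (h.measure_copySet_ne_top _ _)
  refine Integrable.ae_eq_zero_of_forall_setIntegral_eq_zero hK fun A hA _ => ?_
  rw [Measure.restrict_restrict hA]
  refine inter_copySet_induction (P := fun A => ∫ x in A, f x ∂ν = 0) (by simp) ?_ ?_ ?_ ?_ ?_ hA
  · exact fun n k _ => hf' n k
  · intro A B _ _ hAB _ _ he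
    rw [← setIntegral_congr_set (ae_eq_of_diff_triadicPoints h hAB), he]
  · intro A B _ hB hAB hAK hBK hA' hB'
    rw [setIntegral_union₀ (measure_mono_null hAB h.measure_triadicPoints) hB.nullMeasurableSet
      (hK.mono_set hAK) (hK.mono_set hBK), hA', hB', add_zero]
  · intro A hA hs he
    rw [setIntegral_sdiff₀ hA.nullMeasurableSet hK hs, he, hf', sub_zero]
  · intro A hm hd hs he
    rw [integral_iUnion hm hd (hK.mono_set (iUnion_subset hs))]
    simp only [he, tsum_zero]

theorem orthogonal_span_wavelet :
    (Submodule.span ℂ (range fun p : Fin 2 × ℤ × ℤ => h.wavelet p.1 p.2.1 p.2.2))ᗮ = ⊥ := by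
  refine (Submodule.eq_bot_iff _).2 fun f hf => h.eq_zero_of_inner_chi (h.inner_chi_eq_zero ?_)
  intro i j k
  exact (Submodule.mem_orthogonal _ _).1 hf _ (Submodule.subset_span ⟨(i, j, k), rfl⟩)

end IsSelfSimilar

end CantorWavelet

open CantorWavelet in
/-- The measure `ν` on the filled-out Cantor set `R` is the one and only measure with the
characterizing properties, and the wavelet system is an orthonormal basis of `L²(R, ν)`. -/
theorem theorem5p4 :
    (IsCantorMeasure filledCantorMeasure ∧
      ∀ ν : Measure filledCantorSet, IsCantorMeasure ν → ν = filledCantorMeasure) ∧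
    ∃ b : HilbertBasis (Fin 2 × ℤ × ℤ) ℂ (Lp ℂ 2 filledCantorMeasure),
      ∀ (i : Fin 2) (j k : ℤ),
        (b (i, j, k) : filledCantorSet → ℂ) =ᵐ[filledCantorMeasure] waveletFun i j k := by
  have h := isSelfSimilar_filledCantorMeasure
  refine ⟨⟨h.isCantorMeasure, fun ν hν => hν.isSelfSimilar.eq h⟩,
    HilbertBasis.mkOfOrthogonalEqBot h.orthonormal_wavelet h.orthogonal_span_wavelet,
    fun i j k => ?_⟩
  rw [HilbertBasis.coe_mkOfOrthogonalEqBot]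
  exact h.coeFn_wavelet i j k
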